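/- Throughout, graphs are finite, simple and undirected, and a graph is subcubic if its maximum degree is at most $3$. A matching $M$ in a graph $G$ is acyclic if the subgraph of $G$ induced by the set of vertices incident to some edge of $M$ is a forest; the acyclic matching number $\nu_{ac}(G)$ is the maximum size of an acyclic matching in $G$, and $m(G)$ is the number of edges of $G$. Let $K_4^+$ be the graph that arises from the complete graph $K_4$ by subdividing one edge once. **Theorem.** If $G$ is a connected subcubic graph that is isomorphic neither to $K_4^+$ nor to the complete bipartite graph $K_{3,3}$, then $\nu_{ac}(G)\ge m(G)/6$. -/

import Mathlib

namespace SimpleGraph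

/-- A subgraph `M` of `G` is an acyclic matching if it is a matching and the subgraph of `G` induced
by the set of vertices incident to some edge of `M` is a forest. (For a matching `M`, every vertex
of `M` is incident to exactly one edge of `M`, so that set is `M.verts`.) -/
def IsAcyclicMatching {V : Type*} (G : SimpleGraph V) (M : G.Subgraph) : Prop :=
  M.IsMatching ∧ (G.induce M.verts).IsAcyclic

/-- The acyclic matching number: the maximum number of edges of an acyclic matching in `G`. -/
noncomputable def acyclicMatchingNumber {V : Type*} (G : SimpleGraph V) : ℕ :=
  sSup {k : ℕ | ∃ M : G.Subgraph, G.IsAcyclicMatching M ∧ M.edgeSet.ncard = k}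

/-- On a finite graph the supremum above is an attained maximum. -/
theorem isGreatest_acyclicMatchingNumber {V : Type*} [Finite V] (G : SimpleGraph V) :
    IsGreatest {k : ℕ | ∃ M : G.Subgraph, G.IsAcyclicMatching M ∧ M.edgeSet.ncard = k}
      G.acyclicMatchingNumber := by
  have hne : {k : ℕ | ∃ M : G.Subgraph, G.IsAcyclicMatching M ∧ M.edgeSet.ncard = k}.Nonempty := by
    refine ⟨_, ⊥, ⟨fun v hv => absurd hv (by simp), ?_⟩, rfl⟩
    rintro ⟨v, hv⟩
    exact absurd hv (by simp)
  have hbdd : BddAbove {k : ℕ | ∃ M : G.Subgraph, G.IsAcyclicMatching M ∧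
      M.edgeSet.ncard = k} := by
    refine ⟨G.edgeSet.ncard, ?_⟩
    rintro k ⟨M, -, rfl⟩
    exact Set.ncard_le_ncard M.edgeSet_subset (Set.toFinite _)
  exact ⟨Nat.sSup_mem hne hbdd, fun k hk => le_csSup hbdd hk⟩

/-- The graph `K₄⁺` obtained from the complete graph on `{0, 1, 2, 3}` by subdividing the
edge `01` once, the new vertex being `4`. -/
def K4Plus : SimpleGraph (Fin 5) :=
  SimpleGraph.fromEdgeSet
    {s(0, 4), s(4, 1), s(0, 2), s(0, 3), s(1, 2), s(1, 3), s(2, 3)}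

end SimpleGraph

set_option linter.unusedSectionVars false

/-! Induct over vertex sets `W`, proving that twice the number of edges of `G[W]` is at most `6 *
F.card + 2 * G.apexCount W` for some matched forest `F ⊆ W`. Since `F.card` is twice the size of the
matching, this says m ≤ 6ν plus the number of `K₄⁺` components. The correction is needed because
deleting vertices may create such components. `K₃,₃` needs none: being cubic, it would be all of the
connected graph `G`.

For connected `W`, grow a maximal matched tree `T`, delete `T` and its rim, and join `T` to the
forest found in the outer part; no edge runs between them. Counting
(`IsMaximalTree.pairsBetween_add`) bounds the loss in degree sum by `6 * T.card + 6`, less 4 for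
each unit by which a degree in `T` falls short of 3, and less the savings at the rim. It remains to
recover the surplus 6.

If `W` contains `K₄⁺` or `K₃,₃` minus an edge, a tree of four vertices leaves two adjacent vertices
with two neighbours each in it, and these save 6 (`exists_forest_of_adj`). Otherwise no `K₄⁺`
components can arise. A vertex of degree at most two put into `T` gives 4, and another deficiency or
a vertex with two neighbours in `T` gives the rest up to parity. In the cubic case such a vertex
suffices by a divisibility argument modulo 6. Its existence is `exists_matchedTree_two_le`: without
it, local exchanges of tree edges force one of the two excluded configurations. -/

namespace SimpleGraph

/-! ### Degrees into sets, matched forests and trees, exceptional configurations -/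

variable {V : Type*} [DecidableEq V] (G : SimpleGraph V) [DecidableRel G.Adj]

/-- The number of neighbours of `v` in the finite set `X`. -/
def degIn (v : V) (X : Finset V) : ℕ := (X.filter (G.Adj v)).card

/-- The number of pairs `(x, y) ∈ X × Y` with `x` adjacent to `y`. -/
def pairsBetween (X Y : Finset V) : ℕ := ∑ x ∈ X, G.degIn x Y

/-- A set of vertices inducing a forest with a perfect matching, built by successively adding
matching edges `x y` such that at most one edge joins `{x, y}` to the previous set. -/
inductive MatchedForest : Finset V → Prop
  | empty : MatchedForest ∅
  | step (F : Finset V) (x y : V) : MatchedForest F → x ∉ F → y ∉ F → G.Adj x y →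
      G.degIn x F ≤ 1 → G.degIn y F = 0 → MatchedForest (insert x (insert y F))

/-- A set of vertices inducing a tree with a perfect matching, built from an edge at `v` by
successively adding matching edges `x y` such that exactly one edge joins `{x, y}` to the previous
set. -/
inductive MatchedTree (v : V) : Finset V → Prop
  | base (u : V) : G.Adj v u → MatchedTree v {v, u}
  | step (T : Finset V) (x y : V) : MatchedTree v T → x ∉ T → y ∉ T → G.Adj x y →
      G.degIn x T = 1 → G.degIn y T = 0 → MatchedTree v (insert x (insert y T))

/-- `W` has no proper nonempty subset that is a union of components of `G[W]`. -/
def ConnectedOn (W : Finset V) : Prop :=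
  ∀ X ⊆ W, X.Nonempty → (∀ x ∈ X, ∀ y ∈ W, G.Adj x y → y ∈ X) → X = W

/-- The graph `K₄⁺`, with degree two vertex `e`, whose neighbours are `a` and `b`, as a
subgraph. -/
def HasK4PlusAt (a b c d e : V) : Prop :=
  G.Adj e a ∧ G.Adj e b ∧ G.Adj a c ∧ G.Adj a d ∧ G.Adj b c ∧ G.Adj b d ∧ G.Adj c d ∧
    a ≠ b ∧ e ≠ c ∧ e ≠ d

/-- The graph `K₃,₃` minus the edge `a x` as a subgraph. -/
def HasK33MinusAt (a b c x y z : V) : Prop :=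
  (a ≠ b ∧ a ≠ c ∧ b ≠ c ∧ x ≠ y ∧ x ≠ z ∧ y ≠ z) ∧
    G.Adj a y ∧ G.Adj a z ∧ G.Adj b x ∧ G.Adj b y ∧ G.Adj b z ∧ G.Adj c x ∧ G.Adj c y ∧ G.Adj c z

/-- The vertex `e` is the degree two vertex of a component of `G[W]` isomorphic to `K₄⁺`. -/
def IsApex (W : Finset V) (e : V) : Prop :=
  e ∈ W ∧ G.degIn e W = 2 ∧ ∃ a ∈ W, ∃ b ∈ W, ∃ c ∈ W, ∃ d ∈ W, G.HasK4PlusAt a b c d e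

open Classical in
/-- The number of components of `G[W]` isomorphic to `K₄⁺`, when `G` is subcubic. -/
noncomputable def apexCount (W : Finset V) : ℕ := (W.filter (G.IsApex W)).card

variable {G}

/-! ### Counting neighbours and adjacent pairs -/

lemma degIn_eq_zero {v : V} {X : Finset V} : G.degIn v X = 0 ↔ ∀ x ∈ X, ¬ G.Adj v x := by
  simp [degIn, Finset.filter_eq_empty_iff]

lemma degIn_pos {v : V} {X : Finset V} : 0 < G.degIn v X ↔ ∃ x ∈ X, G.Adj v x := by
  simp [degIn, Finset.card_pos, Finset.Nonempty]

lemma degIn_mono {v : V} {X Y : Finset V} (h : X ⊆ Y) : G.degIn v X ≤ G.degIn v Y :=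
  Finset.card_le_card (Finset.filter_subset_filter _ h)

lemma degIn_union {v : V} {X Y : Finset V} (h : Disjoint X Y) :
    G.degIn v (X ∪ Y) = G.degIn v X + G.degIn v Y := by
  rw [degIn, Finset.filter_union, Finset.card_union_of_disjoint]
  · rfl
  · exact Finset.disjoint_filter_filter h

lemma degIn_insert {v x : V} {X : Finset V} (h : x ∉ X) :
    G.degIn v (insert x X) = G.degIn v X + if G.Adj v x then 1 else 0 := by
  rw [degIn, Finset.filter_insert]
  split_ifs
  · rw [Finset.card_insert_of_notMem (by simp [h])]; rfl
  · rfl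

lemma degIn_insert_insert {v x y : V} {X : Finset V} (hxy : x ≠ y) (hx : x ∉ X) (hy : y ∉ X) :
    G.degIn v (insert x (insert y X)) =
      G.degIn v X + (if G.Adj v y then 1 else 0) + if G.Adj v x then 1 else 0 := by
  rw [degIn_insert (by simp [hxy, hx]), degIn_insert hy]

lemma degIn_pair {v x y : V} (hxy : x ≠ y) :
    G.degIn v {x, y} = (if G.Adj v y then 1 else 0) + if G.Adj v x then 1 else 0 := by
  rw [degIn_insert (by simpa using hxy), ← insert_empty_eq, degIn_insert (by simp),
    degIn_eq_zero.2 (by simp), zero_add]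

lemma one_lt_degIn {v : V} {X : Finset V} {x y : V} (hx : x ∈ X) (hy : y ∈ X) (hxy : x ≠ y)
    (hvx : G.Adj v x) (hvy : G.Adj v y) : 2 ≤ G.degIn v X :=
  Finset.one_lt_card.2 ⟨x, by simp [hx, hvx], y, by simp [hy, hvy], hxy⟩

lemma eq_of_degIn_le_one {v : V} {X : Finset V} {x y : V} (h : G.degIn v X ≤ 1) (hx : x ∈ X)
    (hy : y ∈ X) (hvx : G.Adj v x) (hvy : G.Adj v y) : x = y := by
  by_contra hxy
  have := one_lt_degIn hx hy hxy hvx hvy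
  omega

lemma eq_or_eq_of_degIn_le_two {v : V} {X : Finset V} {x y z : V} (h : G.degIn v X ≤ 2)
    (hx : x ∈ X) (hy : y ∈ X) (hz : z ∈ X) (hvx : G.Adj v x) (hvy : G.Adj v y)
    (hvz : G.Adj v z) (hxy : x ≠ y) : z = x ∨ z = y := by
  by_contra hc
  push Not at hc
  have : 2 < (X.filter (G.Adj v)).card := Finset.two_lt_card.2
    ⟨x, by simp [hx, hvx], y, by simp [hy, hvy], z, by simp [hz, hvz], hxy, hc.1.symm, hc.2.symm⟩
  rw [degIn] at h
  omega

lemma eq_of_three_adj (hsub : ∀ v (X : Finset V), G.degIn v X ≤ 3) {v x y z t : V}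
    (hx : G.Adj v x) (hy : G.Adj v y) (hz : G.Adj v z) (ht : G.Adj v t)
    (hxy : x ≠ y) (hxz : x ≠ z) (hyz : y ≠ z) : t = x ∨ t = y ∨ t = z := by
  by_contra hc
  push Not at hc
  have h1 : ({x, y, z, t} : Finset V).card = 4 := by
    rw [Finset.card_eq_succ]
    refine ⟨x, {y, z, t}, by simp [hxy, hxz, hc.1.symm], rfl, ?_⟩
    rw [Finset.card_eq_three]
    exact ⟨y, z, t, hyz, hc.2.1.symm, hc.2.2.symm, rfl⟩
  have h2 := hsub v {x, y, z, t}
  rw [degIn, Finset.filter_true_of_mem (by simp [hx, hy, hz, ht]), h1] at h2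
  omega

lemma pairsBetween_comm (X Y : Finset V) : G.pairsBetween X Y = G.pairsBetween Y X := by
  have := Finset.sum_card_bipartiteAbove_eq_sum_card_bipartiteBelow (s := X) (t := Y) G.Adj
  simp only [Finset.bipartiteAbove, Finset.bipartiteBelow] at this
  simp only [pairsBetween, degIn, this]
  simp only [G.adj_comm]

lemma pairsBetween_union_left {X Y Z : Finset V} (h : Disjoint X Y) :
    G.pairsBetween (X ∪ Y) Z = G.pairsBetween X Z + G.pairsBetween Y Z :=
  Finset.sum_union h

lemma pairsBetween_union_right {X Y Z : Finset V} (h : Disjoint X Y) :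
    G.pairsBetween Z (X ∪ Y) = G.pairsBetween Z X + G.pairsBetween Z Y := by
  simp only [pairsBetween, degIn_union h, Finset.sum_add_distrib]

lemma pairsBetween_eq_zero {X Y : Finset V} (h : ∀ x ∈ X, ∀ y ∈ Y, ¬ G.Adj x y) :
    G.pairsBetween X Y = 0 :=
  Finset.sum_eq_zero fun x hx => degIn_eq_zero.2 (h x hx)

lemma pairsBetween_insert_self {x : V} {X : Finset V} (h : x ∉ X) :
    G.pairsBetween (insert x X) (insert x X) = G.pairsBetween X X + 2 * G.degIn x X := by
  have hd : Disjoint {x} X := by simpa using h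
  have hs : ∀ Y, G.pairsBetween {x} Y = G.degIn x Y := fun Y => by simp [pairsBetween]
  have h0 : G.degIn x {x} = 0 := degIn_eq_zero.2 (by simp)
  rw [Finset.insert_eq, pairsBetween_union_left hd, pairsBetween_union_right hd,
    pairsBetween_union_right hd, pairsBetween_comm X {x}, hs, hs, h0]
  omega

/-- Used to round the edge estimates: an excess of one in a degree sum is automatically absent. -/
lemma even_pairsBetween_self (X : Finset V) : Even (G.pairsBetween X X) := by
  induction X using Finset.induction_on with
  | empty => simp [pairsBetween]
  | insert x X hx ih =>
    rw [pairsBetween_insert_self hx]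
    exact ih.add (even_two_mul _)

/-! ### Building matched forests and trees -/

/-- The steps that build `T` can be replayed on top of `F`, because vertices of `T` see nothing in
`F`. -/
lemma MatchedForest.union {F T : Finset V} (hT : G.MatchedForest T) (hF : G.MatchedForest F)
    (hdisj : Disjoint T F) (h : ∀ x ∈ T, ∀ y ∈ F, ¬ G.Adj x y) : G.MatchedForest (T ∪ F) := by
  induction hT with
  | empty => simpa using hF
  | step T x y _ hx hy hxy hx1 hy0 ih =>
    simp only [Finset.insert_union]
    simp only [Finset.disjoint_insert_left] at hdisj
    have hd := hdisj.2.2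
    refine .step _ x y (ih hd fun a ha => h a (by simp [ha])) ?_ ?_ hxy ?_ ?_
    · simp [hx, hdisj.1]
    · simp [hy, hdisj.2.1]
    · rw [degIn_union hd, degIn_eq_zero.2 (h x (by simp))]; exact hx1
    · rw [degIn_union hd, degIn_eq_zero.2 (h y (by simp)), hy0]

lemma MatchedForest.pair {x y : V} (h : G.Adj x y) : G.MatchedForest {x, y} := by
  have := MatchedForest.step (G := G) ∅ x y .empty (by simp) (by simp) h
    (by simp [degIn]) (by simp [degIn])
  simpa using this

namespace MatchedTree

variable {v : V} {T W : Finset V}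

lemma matchedForest (h : G.MatchedTree v T) : G.MatchedForest T := by
  induction h with
  | base u hu => exact .pair hu
  | step T x y _ hx hy hxy hx1 hy0 ih => exact .step T x y ih hx hy hxy hx1.le hy0

lemma mem (h : G.MatchedTree v T) : v ∈ T := by
  induction h with
  | base u hu => simp
  | step T x y _ _ _ _ _ _ ih => simp [ih]

/-- A tree has one edge fewer than vertices; each step adds two vertices and two edges. -/
lemma pairsBetween_self (h : G.MatchedTree v T) : G.pairsBetween T T + 2 = 2 * T.card := by
  induction h with
  | base u hu =>
    rw [pairsBetween_insert_self (by simpa using hu.ne), Finset.card_pair hu.ne]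
    simp [pairsBetween, degIn, hu, Finset.filter_singleton]
  | step T x y _ hx hy hxy hx1 hy0 ih =>
    have hx' : x ∉ insert y T := by simp [hx, hxy.ne]
    rw [pairsBetween_insert_self hx', pairsBetween_insert_self hy, Finset.card_insert_of_notMem hx',
      Finset.card_insert_of_notMem hy, degIn_insert hy, if_pos hxy]
    omega

/-- Every matched tree in `W` extends to a maximal one, and this does not absorb vertices with at
least two neighbours in the tree. -/
lemma exists_maximal (h : G.MatchedTree v T) (hTW : T ⊆ W) :
    ∃ T', T ⊆ T' ∧ T' ⊆ W ∧ G.MatchedTree v T' ∧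
      (∀ x ∈ W, x ∉ T' → ∀ y ∈ W, y ∉ T' → G.Adj x y → G.degIn x T' = 1 → G.degIn y T' ≠ 0) ∧
      ∀ z, z ∉ T → 2 ≤ G.degIn z T → z ∉ T' := by
  induction hn : W.card - T.card using Nat.strong_induction_on generalizing T with
  | _ n ih =>
    by_cases hmax : ∀ x ∈ W, x ∉ T → ∀ y ∈ W, y ∉ T → G.Adj x y → G.degIn x T = 1 →
        G.degIn y T ≠ 0
    · exact ⟨T, subset_rfl, hTW, h, hmax, fun z hz _ => hz⟩
    · push Not at hmax
      obtain ⟨x, hxW, hx, y, hyW, hy, hxy, hx1, hy0⟩ := hmax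
      have hsubW : insert x (insert y T) ⊆ W := by
        simp [Finset.insert_subset_iff, hxW, hyW, hTW]
      have hcard : (insert x (insert y T)).card = T.card + 2 := by
        rw [Finset.card_insert_of_notMem (by simp [hx, hxy.ne]), Finset.card_insert_of_notMem hy]
      have hle := Finset.card_le_card hsubW
      have hsub : T ⊆ insert x (insert y T) := fun a ha => by simp [ha]
      obtain ⟨T', h1, h2, h3, h4, h5⟩ :=
        ih _ (by omega) (.step T x y h hx hy hxy hx1 hy0) hsubW rfl
      refine ⟨T', hsub.trans h1, h2, h3, h4, fun z hz hz2 => h5 z ?_ (hz2.trans (degIn_mono hsub))⟩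
      rintro hz'
      simp only [Finset.mem_insert] at hz'
      -- The two new vertices have one and zero neighbours in `T`, so neither can be `z`.
      rcases hz' with rfl | rfl | hz'
      · omega
      · omega
      · exact hz hz'

end MatchedTree

/-! ### Finding a vertex with two neighbours in a tree -/

lemma exists_two_of_degIn {v : V} {X : Finset V} (h : 2 ≤ G.degIn v X) :
    ∃ x ∈ X, ∃ y ∈ X, x ≠ y ∧ G.Adj v x ∧ G.Adj v y := by
  obtain ⟨x, hx, y, hy, hxy⟩ := Finset.one_lt_card.1 (show 1 < (X.filter (G.Adj v)).card from h)
  simp only [Finset.mem_filter] at hx hy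
  exact ⟨x, hx.1, y, hy.1, hxy, hx.2, hy.2⟩

lemma degIn_sdiff {v : V} {X Y : Finset V} (h : X ⊆ Y) :
    G.degIn v Y = G.degIn v X + G.degIn v (Y \ X) := by
  rw [← degIn_union Finset.disjoint_sdiff, Finset.union_sdiff_of_subset h]

/-- If all vertices outside a tree have at most one neighbour in it and the tree is maximal, then
every vertex outside the tree has exactly one neighbour in it. -/
lemma ConnectedOn.degIn_eq_one {W T : Finset V} (hconn : G.ConnectedOn W) (hTW : T ⊆ W)
    (hne : T.Nonempty)
    (hmax : ∀ x ∈ W, x ∉ T → ∀ y ∈ W, y ∉ T → G.Adj x y → G.degIn x T = 1 → G.degIn y T ≠ 0)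
    (hle : ∀ z ∈ W, z ∉ T → G.degIn z T ≤ 1) {z : V} (hz : z ∈ W) (hzT : z ∉ T) :
    G.degIn z T = 1 := by
  -- `T` together with its neighbours is closed under adjacency: a neighbour of an outside vertex
  -- with exactly one neighbour in `T` must itself see `T`, by maximality.
  have hX := hconn (W.filter fun x => x ∈ T ∨ 0 < G.degIn x T) (Finset.filter_subset _ _) (by
    obtain ⟨t, ht⟩ := hne
    exact ⟨t, by simp [ht, hTW ht]⟩) (by
    intro x hx y hy hxy
    simp only [Finset.mem_filter] at hx ⊢
    refine ⟨hy, ?_⟩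
    by_cases hyT : y ∈ T
    · exact .inl hyT
    right
    by_cases hxT : x ∈ T
    · exact degIn_pos.2 ⟨x, hxT, hxy.symm⟩
    · have h1 := hle x hx.1 hxT
      have h2 := hx.2.resolve_left hxT
      exact Nat.pos_of_ne_zero (hmax x hx.1 hxT y hy hyT hxy (by omega)))
  rw [← hX, Finset.mem_filter] at hz
  have h1 := hle z (hX ▸ Finset.mem_filter.2 hz) hzT
  have h2 := hz.2.resolve_left hzT
  omega

/-- The situation in which the tree is a single edge. -/
lemma false_of_spanning_edge {W : Finset V} {v u : V} (hvu : G.Adj v u)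
    (hvW : v ∈ W) (huW : u ∈ W)
    (hK4 : ∀ a ∈ W, ∀ b ∈ W, ∀ c ∈ W, ∀ d ∈ W, ∀ e ∈ W, ¬ G.HasK4PlusAt a b c d e)
    (hK33 : ∀ a ∈ W, ∀ b ∈ W, ∀ c ∈ W, ∀ x ∈ W, ∀ y ∈ W, ∀ z ∈ W, ¬ G.HasK33MinusAt a b c x y z)
    (hv : 2 ≤ G.degIn v W) (hsub : ∀ v (X : Finset V), G.degIn v X ≤ 3)
    (hdeg : ∀ y ∈ W, y ≠ v → G.degIn y W = 3)
    (hgood : ∀ T ⊆ W, G.MatchedTree v T → ∀ z ∈ W, z ∉ T → G.degIn z T ≤ 1)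
    (hone : ∀ z ∈ W, z ∉ ({v, u} : Finset V) → G.degIn z {v, u} = 1) : False := by
  have hsubW : ({v, u} : Finset V) ⊆ W := by simp [Finset.insert_subset_iff, hvW, huW]
  set R := W \ {v, u} with hR
  have hmemR : ∀ z, z ∈ R ↔ z ∈ W ∧ z ≠ v ∧ z ≠ u := by simp [hR]
  have hRtwo : ∀ z ∈ R, G.degIn z R = 2 := by
    intro z hz
    have hz' := (hmemR z).1 hz
    have h1 : G.degIn z W = G.degIn z {v, u} + G.degIn z R := degIn_sdiff hsubW
    rw [hdeg z hz'.1 hz'.2.1, hone z hz'.1 (by simp [hz'.2])] at h1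
    omega
  have hRadj : ∀ z ∈ R, G.Adj v z ∨ G.Adj u z := by
    intro z hz
    have hz' := (hmemR z).1 hz
    obtain ⟨t, ht, hzt⟩ := degIn_pos.1 (by rw [hone z hz'.1 (by simp [hz'.2])]; exact one_pos)
    simp only [Finset.mem_insert, Finset.mem_singleton] at ht
    rcases ht with rfl | rfl
    · exact .inl hzt.symm
    · exact .inr hzt.symm
  have hu2 : G.degIn u R = 2 := by
    have h1 : G.degIn u W = G.degIn u {v, u} + G.degIn u R := degIn_sdiff hsubW
    rw [hdeg u huW hvu.ne', degIn_pair hvu.ne, if_neg (by simp), if_pos hvu.symm] at h1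
    omega
  have hvR : G.degIn v W = 1 + G.degIn v R := by
    have h1 : G.degIn v W = G.degIn v {v, u} + G.degIn v R := degIn_sdiff hsubW
    rwa [degIn_pair hvu.ne, if_pos hvu, if_neg (by simp)] at h1
  obtain ⟨p, hp, q, hq, hpq, hup, huq⟩ := exists_two_of_degIn hu2.ge
  have hpq' : ∀ z ∈ R, G.Adj u z → z = p ∨ z = q := fun z hz huz =>
    eq_or_eq_of_degIn_le_two hu2.le hp hq hz hup huq huz hpq
  obtain ⟨y, hy, hvy⟩ := degIn_pos.1 (show 0 < G.degIn v R by omega)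
  have hvu_disj : ∀ z ∈ R, G.Adj v z → ¬ G.Adj u z := by
    intro z hz hvz huz
    have hz' := (hmemR z).1 hz
    have h1 := hone z hz'.1 (by simp [hz'.2])
    rw [degIn_pair hvu.ne, if_pos huz.symm, if_pos hvz.symm] at h1
    omega
  have hpW := (hmemR p).1 hp
  have hqW := (hmemR q).1 hq
  have hyW := (hmemR y).1 hy
  have hyp : y ≠ p := fun h => hvu_disj y hy hvy (h ▸ hup)
  have hyq : y ≠ q := fun h => hvu_disj y hy hvy (h ▸ huq)
  by_cases h2 : 2 ≤ G.degIn v R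
  · obtain ⟨y₁, hy₁, y₂, hy₂, hy₁₂, hvy₁, hvy₂⟩ := exists_two_of_degIn h2
    have hvR2 : G.degIn v R ≤ 2 := by have := hsub v W; omega
    have hW₁ := (hmemR y₁).1 hy₁
    have hW₂ := (hmemR y₂).1 hy₂
    -- Otherwise `y₂` has two neighbours in the tree on the edge `v y₁`.
    have hnadj : ¬ G.Adj y₁ y₂ := by
      intro hadj
      have h1 := hgood {v, y₁} (by simp [Finset.insert_subset_iff, hvW, hW₁.1]) (.base _ hvy₁) y₂
        hW₂.1 (by simp [hW₂, hy₁₂.symm])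
      rw [degIn_pair hvy₁.ne, if_pos hadj.symm, if_pos hvy₂.symm] at h1
      omega
    have key : ∀ a ∈ R, ∀ b ∈ R, a ≠ b → G.Adj v a → G.Adj v b → ¬ G.Adj a b →
        G.Adj a p ∧ G.Adj a q := by
      intro a ha b hb hab hva hvb hnab
      obtain ⟨s, hs, t, ht, hst, has, hat⟩ := exists_two_of_degIn (hRtwo a ha).ge
      have hcase : ∀ s ∈ R, G.Adj a s → s = p ∨ s = q := by
        intro s hs has
        rcases hRadj s hs with hvs | hus
        · rcases eq_or_eq_of_degIn_le_two hvR2 ha hb hs hva hvb hvs hab with rfl | rfl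
          · exact absurd has (G.irrefl)
          · exact absurd has hnab
        · exact hpq' s hs hus
      rcases hcase s hs has with rfl | rfl <;> rcases hcase t ht hat with rfl | rfl
      · exact absurd rfl hst
      · exact ⟨has, hat⟩
      · exact ⟨hat, has⟩
      · exact absurd rfl hst
    have k1 := key y₁ hy₁ y₂ hy₂ hy₁₂ hvy₁ hvy₂ hnadj
    have k2 := key y₂ hy₂ y₁ hy₁ hy₁₂.symm hvy₂ hvy₁ fun h => hnadj h.symm
    -- The parts are `{v, p, q}` and `{u, y₁, y₂}`.
    exact hK33 v hvW p hpW.1 q hqW.1 u huW y₁ hW₁.1 y₂ hW₂.1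
      ⟨⟨hpW.2.1.symm, hqW.2.1.symm, hpq, hW₁.2.2.symm, hW₂.2.2.symm, hy₁₂⟩,
        hvy₁, hvy₂, hup.symm, k1.1.symm, k2.1.symm, huq.symm, k1.2.symm, k2.2.symm⟩
  -- Here `v` has degree two, and the 2-regular graph on `R` is the triangle `y p q`; this gives
  -- `K₄⁺` with apex `v`.
  · have hRy : ∀ z ∈ R, z = y ∨ z = p ∨ z = q := by
      intro z hz
      rcases hRadj z hz with h | h
      · exact .inl (eq_of_degIn_le_one (by omega) hz hy h hvy)
      · exact .inr (hpq' z hz h)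
    have key : ∀ a ∈ R, ∀ b c, (∀ z ∈ R, z = a ∨ z = b ∨ z = c) → G.Adj a b ∧ G.Adj a c := by
      intro a ha b c h
      obtain ⟨s, hs, t, ht, hst, has, hat⟩ := exists_two_of_degIn (hRtwo a ha).ge
      have hsa := has.ne'
      have hta := hat.ne'
      rcases (h s hs).resolve_left hsa with rfl | rfl <;>
        rcases (h t ht).resolve_left hta with rfl | rfl
      · exact absurd rfl hst
      · exact ⟨has, hat⟩
      · exact ⟨hat, has⟩
      · exact absurd rfl hst
    have k1 := key y hy p q hRy
    have k2 := key p hp y q fun z hz => by have := hRy z hz; tauto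
    exact hK4 u huW y hyW.1 p hpW.1 q hqW.1 v hvW ⟨hvu, hvy, hup, huq, k1.1, k1.2, k2.2,
      hyW.2.2.symm, hpW.2.1.symm, hqW.2.1.symm⟩

/-- The situation in which the tree arises from a smaller tree by adding the edge `p l`. -/
lemma false_of_spanning_step {W T : Finset V} {v p l : V} (hT : G.MatchedTree v T)
    (hTW : T ⊆ W) (hpW : p ∈ W) (hlW : l ∈ W)
    (hpT : p ∉ T) (hlT : l ∉ T) (hpl : G.Adj p l) (hp1 : G.degIn p T = 1) (hl0 : G.degIn l T = 0)
    (hK4 : ∀ a ∈ W, ∀ b ∈ W, ∀ c ∈ W, ∀ d ∈ W, ∀ e ∈ W, ¬ G.HasK4PlusAt a b c d e)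
    (hK33 : ∀ a ∈ W, ∀ b ∈ W, ∀ c ∈ W, ∀ x ∈ W, ∀ y ∈ W, ∀ z ∈ W, ¬ G.HasK33MinusAt a b c x y z)
    (hdeg : ∀ y ∈ W, y ≠ v → G.degIn y W = 3)
    (hgood : ∀ T ⊆ W, G.MatchedTree v T → ∀ z ∈ W, z ∉ T → G.degIn z T ≤ 1)
    (hone : ∀ z ∈ W, z ∉ insert p (insert l T) → G.degIn z (insert p (insert l T)) = 1) :
    False := by
  have hvT := hT.mem
  have hsubW : insert p (insert l T) ⊆ W := by
    simp [Finset.insert_subset_iff, hpW, hlW, hTW]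
  set R := W \ insert p (insert l T) with hR
  have hmemR : ∀ z, z ∈ R ↔ z ∈ W ∧ z ≠ p ∧ z ≠ l ∧ z ∉ T := by
    intro z; simp [hR]
  have hnev : ∀ z, z ∉ T → z ≠ v := fun z hz h => hz (h ▸ hvT)
  have hdegs : ∀ z, G.degIn z (insert p (insert l T)) =
      G.degIn z T + (if G.Adj z l then 1 else 0) + if G.Adj z p then 1 else 0 :=
    fun z => degIn_insert_insert hpl.ne hpT hlT
  have hsplit : ∀ z ∈ W, z ∉ T → 3 = G.degIn z (insert p (insert l T)) + G.degIn z R :=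
    fun z hz hzT => (hdeg z hz (hnev z hzT)).symm.trans (degIn_sdiff hsubW)
  have hRone : ∀ z ∈ R, G.degIn z (insert p (insert l T)) = 1 := fun z hz => by
    have := (hmemR z).1 hz
    exact hone z this.1 (by simp [this.2])
  have hRtwo : ∀ z ∈ R, G.degIn z R = 2 := by
    intro z hz
    have := (hmemR z).1 hz
    have h1 := hsplit z this.1 this.2.2.2
    rw [hRone z hz] at h1
    omega
  have hpR : G.degIn p R = 1 := by
    have h1 := hsplit p hpW hpT
    rw [hdegs, hp1, if_pos hpl, if_neg (by simp)] at h1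
    omega
  have hlR : G.degIn l R = 2 := by
    have h1 := hsplit l hlW hlT
    rw [hdegs, hl0, if_pos hpl.symm, if_neg (by simp)] at h1
    omega
  obtain ⟨p₁, hp₁, hpp₁⟩ := degIn_pos.1 (show 0 < G.degIn p R by omega)
  obtain ⟨l₁, hl₁, l₂, hl₂, hl₁₂, hll₁, hll₂⟩ := exists_two_of_degIn hlR.ge
  -- A vertex of `R` adjacent to `p` or `l` has no neighbour in `T`.
  have hTp : ∀ z ∈ R, G.Adj p z → G.degIn z T = 0 ∧ ¬ G.Adj l z := by
    intro z hz h
    have h1 := hRone z hz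
    rw [hdegs, if_pos h.symm] at h1
    refine ⟨by omega, fun h' => ?_⟩
    rw [if_pos h'.symm] at h1
    omega
  have hTl : ∀ z ∈ R, G.Adj l z → G.degIn z T = 0 ∧ ¬ G.Adj p z := by
    intro z hz h
    refine ⟨?_, fun h' => (hTp z hz h').2 h⟩
    have h1 := hRone z hz
    rw [hdegs, if_pos h.symm] at h1
    omega
  have hTr : ∀ z ∈ R, z ≠ p₁ → z ≠ l₁ → z ≠ l₂ → G.degIn z T = 1 := by
    intro z hz h1 h2 h3
    have hpz : ¬ G.Adj p z := fun h => h1 (eq_of_degIn_le_one hpR.le hz hp₁ h hpp₁)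
    have hlz : ¬ G.Adj l z := fun h => by
      rcases eq_or_eq_of_degIn_le_two hlR.le hl₁ hl₂ hz hll₁ hll₂ h hl₁₂ with h | h
      · exact h2 h
      · exact h3 h
    have h4 := hRone z hz
    rwa [hdegs, if_neg fun h => hlz h.symm, if_neg fun h => hpz h.symm] at h4
  -- The edge `x y` may be added to `T` and then a vertex adjacent to `x` and `T` is forbidden.
  have hadd : ∀ x ∈ W, x ∉ T → ∀ y ∈ W, y ∉ T → G.Adj x y → G.degIn x T = 1 → G.degIn y T = 0 →
      ∀ z ∈ R, z ≠ x → z ≠ y → G.Adj z x ∨ G.Adj z y → G.degIn z T ≠ 1 := by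
    intro x hx hxT y hy hyT hxy hx1 hy0 z hz hzx hzy hadj hz1
    have hz' := (hmemR z).1 hz
    have h1 := hgood _ (by simp [Finset.insert_subset_iff, hx, hy, hTW])
      (.step T x y hT hxT hyT hxy hx1 hy0) z hz'.1 (by simp [hzx, hzy, hz'.2.2.2])
    rw [degIn_insert_insert hxy.ne hxT hyT, hz1] at h1
    rcases hadj with h | h <;> rw [if_pos h] at h1 <;> omega
  have hp₁W := (hmemR p₁).1 hp₁
  have hl₁W := (hmemR l₁).1 hl₁
  have hl₂W := (hmemR l₂).1 hl₂
  have hp₁l₁ : p₁ ≠ l₁ := fun h => (hTp p₁ hp₁ hpp₁).2 (h ▸ hll₁)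
  have hp₁l₂ : p₁ ≠ l₂ := fun h => (hTp p₁ hp₁ hpp₁).2 (h ▸ hll₂)
  -- Exchange `p l` for `p p₁`: any other neighbour of `p₁` in `R` has a neighbour in `T`, hence two
  -- in the new tree.
  have hp₁nbr : ∀ z ∈ R, G.Adj p₁ z → z = l₁ ∨ z = l₂ := by
    intro z hz hadj
    by_contra hc
    push Not at hc
    exact hadd p hpW hpT p₁ hp₁W.1 hp₁W.2.2.2 hpp₁ hp1 (hTp p₁ hp₁ hpp₁).1 z hz
      ((hmemR z).1 hz).2.1 hadj.ne' (.inr hadj.symm) (hTr z hz hadj.ne' hc.1 hc.2)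
  have hp₁adj : G.Adj p₁ l₁ ∧ G.Adj p₁ l₂ := by
    obtain ⟨s, hs, t, ht, hst, has, hat⟩ := exists_two_of_degIn (hRtwo p₁ hp₁).ge
    rcases hp₁nbr s hs has with rfl | rfl <;> rcases hp₁nbr t ht hat with rfl | rfl
    · exact absurd rfl hst
    · exact ⟨has, hat⟩
    · exact ⟨hat, has⟩
    · exact absurd rfl hst
  -- Both `l` and `p₁` are adjacent to `l₁` and `l₂`, so an edge `l₁ l₂` yields `K₄⁺` with apex `p`.
  by_cases hll : G.Adj l₁ l₂
  · exact hK4 l hlW p₁ hp₁W.1 l₁ hl₁W.1 l₂ hl₂W.1 p hpW ⟨hpl, hpp₁, hll₁, hll₂, hp₁adj.1,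
      hp₁adj.2, hll, hp₁W.2.2.1.symm, hl₁W.2.1.symm, hl₂W.2.1.symm⟩
  obtain ⟨r, hr, hrp₁, hl₁r⟩ : ∃ r ∈ R, r ≠ p₁ ∧ G.Adj l₁ r := by
    obtain ⟨s, hs, t, ht, hst, has, hat⟩ := exists_two_of_degIn (hRtwo l₁ hl₁).ge
    by_cases h : s = p₁
    · exact ⟨t, ht, fun h' => hst (h.trans h'.symm), hat⟩
    · exact ⟨s, hs, h, has⟩
  have hrW := (hmemR r).1 hr
  have hrl₂ : r ≠ l₂ := fun h => hll (h ▸ hl₁r)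
  have hr1 := hTr r hr hrp₁ hl₁r.ne' hrl₂
  obtain ⟨s, hs, hsl₁, hrs⟩ : ∃ s ∈ R, s ≠ l₁ ∧ G.Adj r s := by
    obtain ⟨s, hs, t, ht, hst, has, hat⟩ := exists_two_of_degIn (hRtwo r hr).ge
    by_cases h : s = l₁
    · exact ⟨t, ht, fun h' => hst (h.trans h'.symm), hat⟩
    · exact ⟨s, hs, h, has⟩
  have hsp₁ : s ≠ p₁ := by
    rintro rfl
    rcases hp₁nbr r hr hrs.symm with h | h
    · exact hl₁r.ne' h
    · exact hrl₂ h
  -- Now exchange `p l` for `r l₁`: otherwise `s` has one neighbour in `T` and is adjacent to `r`.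
  have hsl₂ : s = l₂ := by
    by_contra hsl₂
    exact hadd r hrW.1 hrW.2.2.2 l₁ hl₁W.1 hl₁W.2.2.2 hl₁r.symm hr1 (hTl l₁ hl₁ hll₁).1 s hs
      hrs.ne' hsl₁ (.inl hrs.symm) (hTr s hs hsp₁ hsl₁ hsl₂)
  subst hsl₂
  -- The parts are `{p, l₁, l₂}` and `{r, l, p₁}`, with `p r` as the edge not required.
  exact hK33 p hpW l₁ hl₁W.1 s hl₂W.1 r hrW.1 l hlW p₁ hp₁W.1
    ⟨⟨hl₁W.2.1.symm, hl₂W.2.1.symm, hl₁₂, hrW.2.2.1, hrp₁, hp₁W.2.2.1.symm⟩, hpl, hpp₁, hl₁r,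
      hll₁.symm, hp₁adj.1.symm, hrs.symm, hll₂.symm, hp₁adj.2.symm⟩

/-- If all vertices have degree three, except possibly one vertex `v` of degree two, then some
matched tree containing `v` has two neighbours of a vertex outside of it. -/
lemma exists_matchedTree_two_le {W : Finset V} {v : V} (hconn : G.ConnectedOn W) (hvW : v ∈ W)
    (hsub : ∀ v (X : Finset V), G.degIn v X ≤ 3)
    (hK4 : ∀ a ∈ W, ∀ b ∈ W, ∀ c ∈ W, ∀ d ∈ W, ∀ e ∈ W, ¬ G.HasK4PlusAt a b c d e)
    (hK33 : ∀ a ∈ W, ∀ b ∈ W, ∀ c ∈ W, ∀ x ∈ W, ∀ y ∈ W, ∀ z ∈ W, ¬ G.HasK33MinusAt a b c x y z)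
    (hv : 2 ≤ G.degIn v W) (hdeg : ∀ y ∈ W, y ≠ v → G.degIn y W = 3) :
    ∃ T ⊆ W, G.MatchedTree v T ∧ ∃ z ∈ W, z ∉ T ∧ 2 ≤ G.degIn z T := by
  by_contra hcon
  have hgood : ∀ T ⊆ W, G.MatchedTree v T → ∀ z ∈ W, z ∉ T → G.degIn z T ≤ 1 := by
    intro T hTW hT z hz hzT
    by_contra h
    exact hcon ⟨T, hTW, hT, z, hz, hzT, by omega⟩
  obtain ⟨u, huW, hvu⟩ := degIn_pos.1 (show 0 < G.degIn v W by omega)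
  obtain ⟨T, -, hTW, hT, hmax, -⟩ := MatchedTree.exists_maximal (W := W) (.base u hvu)
    (by simp [Finset.insert_subset_iff, hvW, huW])
  have hone : ∀ z ∈ W, z ∉ T → G.degIn z T = 1 := fun z hz hzT =>
    hconn.degIn_eq_one hTW ⟨v, hT.mem⟩ hmax (hgood T hTW hT) hz hzT
  -- Expose the last edge added, so that it can be exchanged for others.
  cases hT with
  | base u hvu =>
    exact false_of_spanning_edge hvu hvW (hTW (by simp)) hK4 hK33 hv hsub hdeg hgood hone
  | step T p l hT hp hl hpl hp1 hl0 =>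
    exact false_of_spanning_step hT (fun a ha => hTW (by simp [ha])) (hTW (by simp))
      (hTW (by simp)) hp hl hpl hp1 hl0 hK4 hK33 hdeg hgood hone

/-! ### Rim and outer part of a maximal tree, and the edge count -/

variable (G) in
/-- The vertices of `W` outside `T` that have a neighbour in `T`. -/
def rim (W T : Finset V) : Finset V := W.filter fun x => x ∉ T ∧ 0 < G.degIn x T

variable (G) in
/-- The vertices of `W` outside `T` that have no neighbour in `T`. -/
def outer (W T : Finset V) : Finset V := W.filter fun x => x ∉ T ∧ G.degIn x T = 0

variable (G) in
/-- The amount that `r ∈ G.rim W T` contributes to the difference between the number of edges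
incident with the tree or its rim and the trivial upper bound. -/
def saving (W T : Finset V) (r : V) : ℕ :=
  3 * G.degIn r T - (G.degIn r W + G.degIn r (G.outer W T))

variable (G) in
/-- `T` is a maximal matched tree in `W` containing `v`. -/
structure IsMaximalTree (v : V) (W T : Finset V) : Prop where
  subset : T ⊆ W
  matchedTree : G.MatchedTree v T
  maximal : ∀ x ∈ W, x ∉ T → ∀ y ∈ W, y ∉ T → G.Adj x y → G.degIn x T = 1 → G.degIn y T ≠ 0

lemma mem_rim {W T : Finset V} {x : V} : x ∈ G.rim W T ↔ x ∈ W ∧ x ∉ T ∧ 0 < G.degIn x T := by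
  simp [rim]

lemma mem_outer {W T : Finset V} {x : V} :
    x ∈ G.outer W T ↔ x ∈ W ∧ x ∉ T ∧ G.degIn x T = 0 := by
  simp [outer]

lemma outer_subset {W T : Finset V} : G.outer W T ⊆ W := Finset.filter_subset _ _

namespace IsMaximalTree

variable {v : V} {W T : Finset V}

lemma disjoint_rim : Disjoint T (G.rim W T) :=
  Finset.disjoint_left.2 fun _ hx hx' => (mem_rim.1 hx').2.1 hx

lemma disjoint_outer : Disjoint T (G.outer W T) :=
  Finset.disjoint_left.2 fun _ hx hx' => (mem_outer.1 hx').2.1 hx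

lemma disjoint_union_outer : Disjoint (T ∪ G.rim W T) (G.outer W T) := by
  refine Finset.disjoint_union_left.2 ⟨disjoint_outer, Finset.disjoint_left.2 fun x hx hx' => ?_⟩
  have h1 := (mem_rim.1 hx).2.2
  have h2 := (mem_outer.1 hx').2.2
  omega

lemma union_eq (hTW : T ⊆ W) : T ∪ G.rim W T ∪ G.outer W T = W := by
  ext x
  simp only [Finset.mem_union, mem_rim, mem_outer]
  by_cases hx : x ∈ T
  · simp [hx, hTW hx]
  · rcases Nat.eq_zero_or_pos (G.degIn x T) with h | h <;> simp [hx, h]; omega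

lemma degIn_eq (hTW : T ⊆ W) (x : V) :
    G.degIn x W = G.degIn x T + G.degIn x (G.rim W T) + G.degIn x (G.outer W T) := by
  conv_lhs => rw [← union_eq (G := G) hTW, degIn_union disjoint_union_outer,
    degIn_union disjoint_rim]

lemma not_adj_outer : ∀ x ∈ T, ∀ y ∈ G.outer W T, ¬ G.Adj x y := fun x hx _ hy h =>
  degIn_eq_zero.1 (mem_outer.1 hy).2.2 x hx h.symm

variable (h : G.IsMaximalTree v W T)
include h

/-- An edge from `r` to the outer part could otherwise be added to the tree. -/
lemma degIn_outer_eq_zero {r : V} (hr : r ∈ G.rim W T) (h1 : G.degIn r T = 1) :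
    G.degIn r (G.outer W T) = 0 := by
  rw [degIn_eq_zero]
  intro y hy hadj
  have hr := mem_rim.1 hr
  have hy := mem_outer.1 hy
  exact h.maximal r hr.1 hr.2.1 y hy.1 hy.2.1 hadj h1 hy.2.2

/-- The truncated subtraction in `saving` never truncates on the rim: with one neighbour in `T`
there is none in the outer part, and with at least two the bound 6 exceeds 3 + 1. -/
lemma saving_add (hsub : ∀ v (X : Finset V), G.degIn v X ≤ 3) {r : V} (hr : r ∈ G.rim W T) :
    G.degIn r W + G.degIn r (G.outer W T) + G.saving W T r = 3 * G.degIn r T := by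
  have h1 := hsub r W
  have h2 := degIn_eq (G := G) h.subset r
  have h3 := h.degIn_outer_eq_zero hr
  have h4 := (mem_rim.1 hr).2.2
  rw [saving]
  by_cases h5 : G.degIn r T = 1
  · have := h3 h5
    omega
  · omega

/-- This pays the correction 2 for each `K₄⁺` component cut off by an edge between rim and outer
part. -/
lemma two_mul_le_saving (hsub : ∀ v (X : Finset V), G.degIn v X ≤ 3) {r : V}
    (hr : r ∈ G.rim W T) : 2 * G.degIn r (G.outer W T) ≤ G.saving W T r := by
  have h0 := h.saving_add hsub hr
  have h1 := hsub r W
  have h2 := degIn_eq (G := G) h.subset r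
  have h3 := h.degIn_outer_eq_zero hr
  have h4 := (mem_rim.1 hr).2.2
  by_cases h5 : G.degIn r T = 1
  · have := h3 h5
    omega
  · omega

lemma two_le_saving (hsub : ∀ v (X : Finset V), G.degIn v X ≤ 3) {r : V}
    (hr : r ∈ W) (hrT : r ∉ T) (h2 : 2 ≤ G.degIn r T) :
    2 ≤ ∑ r ∈ G.rim W T, G.saving W T r := by
  have hr' : r ∈ G.rim W T := mem_rim.2 ⟨hr, hrT, by omega⟩
  have h0 := h.saving_add hsub hr'
  have h1 := hsub r W
  have h2 := degIn_eq (G := G) h.subset r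
  have := Finset.single_le_sum (f := G.saving W T) (fun _ _ => Nat.zero_le _) hr'
  omega

/-- The number of edges incident with a tree or its rim. -/
lemma pairsBetween_add (hsub : ∀ v (X : Finset V), G.degIn v X ≤ 3) :
    G.pairsBetween W W + 4 * (∑ x ∈ T, (3 - G.degIn x W)) + ∑ r ∈ G.rim W T, G.saving W T r =
      G.pairsBetween (G.outer W T) (G.outer W T) + 6 * T.card + 6 := by
  -- The degree sum lost is that of `T` plus, over the rim, degrees in `W` and in the outer part.
  -- With total deficiency D in `T`, the first is 3|T| − D. The tree sends |T| + 2 − D edges to the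
  -- rim, and each is charged 3, up to the savings.
  have hleft : ∀ Z, G.pairsBetween W Z = G.pairsBetween T Z + G.pairsBetween (G.rim W T) Z +
      G.pairsBetween (G.outer W T) Z := fun Z => by
    conv_lhs => rw [← union_eq (G := G) h.subset, pairsBetween_union_left disjoint_union_outer,
      pairsBetween_union_left disjoint_rim]
  have hright : ∀ Z, G.pairsBetween Z W = G.pairsBetween Z T + G.pairsBetween Z (G.rim W T) +
      G.pairsBetween Z (G.outer W T) := fun Z => by
    rw [pairsBetween_comm, hleft, pairsBetween_comm T, pairsBetween_comm (G.rim W T),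
      pairsBetween_comm (G.outer W T)]
  have h1 : G.pairsBetween T W + ∑ x ∈ T, (3 - G.degIn x W) = 3 * T.card := by
    rw [pairsBetween, ← Finset.sum_add_distrib, mul_comm, ← smul_eq_mul, ← Finset.sum_const]
    refine Finset.sum_congr rfl fun x _ => ?_
    have := hsub x W
    omega
  have h2 : G.pairsBetween (G.rim W T) W + G.pairsBetween (G.rim W T) (G.outer W T) +
      ∑ r ∈ G.rim W T, G.saving W T r = 3 * G.pairsBetween (G.rim W T) T := by
    simp only [pairsBetween]
    rw [← Finset.sum_add_distrib, ← Finset.sum_add_distrib, Finset.mul_sum]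
    exact Finset.sum_congr rfl fun r hr => h.saving_add hsub hr
  have h3 : G.pairsBetween T (G.outer W T) = 0 := pairsBetween_eq_zero not_adj_outer
  have h4 := h.matchedTree.pairsBetween_self
  have h5 := hleft W
  have h6 := hright T
  have h7 := hright (G.outer W T)
  rw [pairsBetween_comm _ T, h3, pairsBetween_comm _ (G.rim W T)] at h7
  have h8 := pairsBetween_comm (G := G) T (G.rim W T)
  omega

lemma card_outer_lt : (G.outer W T).card < W.card := by
  refine Finset.card_lt_card ⟨outer_subset, fun hc => ?_⟩
  exact (mem_outer.1 (hc (h.subset h.matchedTree.mem))).2.1 h.matchedTree.mem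

lemma exists_forest {n : ℕ} {F : Finset V} (hF : F ⊆ G.outer W T) (hF' : G.MatchedForest F)
    (hle : G.pairsBetween W W ≤ 6 * T.card + 6 * F.card + n) :
    ∃ F ⊆ W, G.MatchedForest F ∧ G.pairsBetween W W ≤ 6 * F.card + n := by
  have hd : Disjoint T F := Finset.disjoint_of_subset_right hF disjoint_outer
  refine ⟨T ∪ F, Finset.union_subset h.subset (hF.trans outer_subset),
    .union h.matchedTree.matchedForest hF' hd fun x hx y hy => not_adj_outer x hx y (hF hy), ?_⟩
  rw [Finset.card_union_of_disjoint hd]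
  omega

omit h in
lemma exists_extension (hT : G.MatchedTree v T) (hTW : T ⊆ W) :
    ∃ T', T ⊆ T' ∧ G.IsMaximalTree v W T' ∧ ∀ z, z ∉ T → 2 ≤ G.degIn z T → z ∉ T' := by
  obtain ⟨T', h1, h2, h3, h4, h5⟩ := hT.exists_maximal hTW
  exact ⟨T', h1, ⟨h2, h3, h4⟩, h5⟩

/-- Each new apex has degree two in the outer part but not in `W`, so it has a neighbour in the rim;
map it to such an edge. -/
lemma apexCount_outer_le (hno : ∀ e, ¬ G.IsApex W e) :
    G.apexCount (G.outer W T) ≤ G.pairsBetween (G.rim W T) (G.outer W T) := by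
  classical
  rw [pairsBetween_comm, apexCount, Finset.card_filter, pairsBetween]
  refine Finset.sum_le_sum fun e he => ?_
  split_ifs with hap
  · obtain ⟨-, h2, a, ha, b, hb, c, hc, d, hd, hK⟩ := hap
    have h3 : G.degIn e W ≠ 2 := fun h3 => hno e ⟨outer_subset he, h3, a, outer_subset ha, b,
      outer_subset hb, c, outer_subset hc, d, outer_subset hd, hK⟩
    have h4 := degIn_eq (G := G) h.subset e
    have h5 := (mem_outer.1 he).2.2
    omega
  · exact Nat.zero_le _

end IsMaximalTree

/-! ### Recovering the surplus 6 -/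

variable {W : Finset V}

/-- The induction step when some tree leaves two adjacent vertices with two neighbours in it. -/
lemma exists_forest_of_adj {v : V} {T : Finset V} (hsub : ∀ v (X : Finset V), G.degIn v X ≤ 3)
    (hno : ∀ e, ¬ G.IsApex W e)
    (ih : ∀ S : Finset V, S.card < W.card → ∃ F ⊆ S, G.MatchedForest F ∧
      G.pairsBetween S S ≤ 6 * F.card + 2 * G.apexCount S)
    (hT : G.MatchedTree v T) (hTW : T ⊆ W) {b c : V} (hb : b ∈ W) (hc : c ∈ W) (hbT : b ∉ T)
    (hcT : c ∉ T) (hbc : G.Adj b c) (hb2 : 2 ≤ G.degIn b T) (hc2 : 2 ≤ G.degIn c T) :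
    ∃ F ⊆ W, G.MatchedForest F ∧ G.pairsBetween W W ≤ 6 * F.card + 2 * G.apexCount W := by
  obtain ⟨T', hTT', h, hout⟩ := IsMaximalTree.exists_extension hT hTW
  have hbT' := hout b hbT hb2
  have hcT' := hout c hcT hc2
  have hb2' := hb2.trans (degIn_mono hTT')
  have hc2' := hc2.trans (degIn_mono hTT')
  have hbR : b ∈ G.rim W T' := mem_rim.2 ⟨hb, hbT', by omega⟩
  have hcR : c ∈ G.rim W T' := mem_rim.2 ⟨hc, hcT', by omega⟩
  have hthree : ∀ x ∈ G.rim W T', ∀ y ∈ G.rim W T', G.Adj x y → 2 ≤ G.degIn x T' →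
      2 * G.degIn x (G.outer W T') + 3 ≤ G.saving W T' x := by
    intro x hx y hy hxy hx2
    have h1 := degIn_pos.2 ⟨y, hy, hxy⟩
    have h2 := IsMaximalTree.degIn_eq (G := G) h.subset x
    have h3 := hsub x W
    have h4 := h.saving_add hsub hx
    omega
  have hsave : 2 * G.pairsBetween (G.rim W T') (G.outer W T') + 6 ≤
      ∑ r ∈ G.rim W T', G.saving W T' r := by
    -- `b` and `c` each spend their third edge inside the rim, so each saves 3 and has no outer
    -- neighbour.
    have h6 : ∑ r ∈ G.rim W T', ((if r = b then 3 else 0) + if r = c then 3 else 0) = 6 := by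
      rw [Finset.sum_add_distrib, Finset.sum_ite_eq', Finset.sum_ite_eq', if_pos hbR, if_pos hcR]
    rw [pairsBetween, Finset.mul_sum, ← h6, ← Finset.sum_add_distrib]
    refine Finset.sum_le_sum fun r hr => ?_
    by_cases hrb : r = b
    · have := hthree b hbR c hcR hbc hb2'
      simpa [hrb, hbc.ne] using this
    · by_cases hrc : r = c
      · have := hthree c hcR b hbR hbc.symm hc2'
        simpa [hrc, hbc.ne'] using this
      · simpa [hrb, hrc] using h.two_mul_le_saving hsub hr
  obtain ⟨F, hF, hF', hle⟩ := ih _ h.card_outer_lt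
  refine h.exists_forest hF hF' ?_
  have h1 := h.apexCount_outer_le hno
  have h2 := h.pairsBetween_add hsub
  omega

/-- The induction step when `W` has a vertex of degree at most two. -/
lemma exists_forest_of_degIn_le_two {v : V} (hconn : G.ConnectedOn W)
    (hsub : ∀ v (X : Finset V), G.degIn v X ≤ 3)
    (hK4 : ∀ a ∈ W, ∀ b ∈ W, ∀ c ∈ W, ∀ d ∈ W, ∀ e ∈ W, ¬ G.HasK4PlusAt a b c d e)
    (hK33 : ∀ a ∈ W, ∀ b ∈ W, ∀ c ∈ W, ∀ x ∈ W, ∀ y ∈ W, ∀ z ∈ W, ¬ G.HasK33MinusAt a b c x y z)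
    (ih : ∀ S ⊆ W, S.card < W.card → ∃ F ⊆ S, G.MatchedForest F ∧
      G.pairsBetween S S ≤ 6 * F.card)
    (hv : v ∈ W) (hv0 : 0 < G.degIn v W) (hv2 : G.degIn v W ≤ 2) :
    ∃ F ⊆ W, G.MatchedForest F ∧ G.pairsBetween W W ≤ 6 * F.card := by
  -- Five suffices instead of six, since all degree sums are even.
  suffices ∃ T, G.IsMaximalTree v W T ∧
      5 ≤ 4 * (∑ x ∈ T, (3 - G.degIn x W)) + ∑ r ∈ G.rim W T, G.saving W T r by
    obtain ⟨T, h, h5⟩ := this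
    obtain ⟨F, hF, hF', hle⟩ := ih _ outer_subset h.card_outer_lt
    refine h.exists_forest hF hF' (n := 0) ?_
    have h2 := h.pairsBetween_add hsub
    obtain ⟨i, hi⟩ := even_pairsBetween_self (G := G) W
    obtain ⟨j, hj⟩ := even_pairsBetween_self (G := G) (G.outer W T)
    omega
  have hone : ∀ {T}, G.IsMaximalTree v W T → 1 ≤ ∑ x ∈ T, (3 - G.degIn x W) := by
    intro T h
    have := Finset.single_le_sum (f := fun x => 3 - G.degIn x W) (fun _ _ => Nat.zero_le _)
      h.matchedTree.mem
    omega
  by_cases hcase : 2 ≤ G.degIn v W ∧ ∀ y ∈ W, y ≠ v → G.degIn y W = 3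
  · obtain ⟨T, hTW, hT, z, hz, hzT, hz2⟩ :=
      exists_matchedTree_two_le hconn hv hsub hK4 hK33 hcase.1 hcase.2
    obtain ⟨T', hTT', h, hout⟩ := IsMaximalTree.exists_extension hT hTW
    have h1 := h.two_le_saving hsub hz (hout z hzT hz2) (hz2.trans (degIn_mono hTT'))
    have h2 := hone h
    exact ⟨T', h, by omega⟩
  obtain ⟨u, hu, hvu⟩ := degIn_pos.1 hv0
  obtain ⟨T, -, h, -⟩ := IsMaximalTree.exists_extension (W := W) (.base u hvu)
    (by simp [Finset.insert_subset_iff, hv, hu])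
  refine ⟨T, h, ?_⟩
  have h1 := hone h
  by_cases hv1 : G.degIn v W ≤ 1
  · have := Finset.single_le_sum (f := fun x => 3 - G.degIn x W) (fun _ _ => Nat.zero_le _)
      h.matchedTree.mem
    omega
  have hex : ∃ y ∈ W, y ≠ v ∧ G.degIn y W ≤ 2 := by
    by_contra hc
    push Not at hc
    refine hcase ⟨by omega, fun y hy hyv => ?_⟩
    have h1 := hc y hy hyv
    have h2 := hsub y W
    omega
  obtain ⟨y, hy, hyv, hy2⟩ := hex
  by_cases hyT : y ∈ T
  · have h2 : ∑ x ∈ {v, y}, (3 - G.degIn x W) ≤ ∑ x ∈ T, (3 - G.degIn x W) :=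
      Finset.sum_le_sum_of_subset
        (by simp [Finset.insert_subset_iff, hyT, h.matchedTree.mem])
    rw [Finset.sum_pair hyv.symm] at h2
    omega
  by_cases hyR : y ∈ G.rim W T
  · have h2 := Finset.single_le_sum (f := G.saving W T) (fun _ _ => Nat.zero_le _) hyR
    have h3 := h.saving_add hsub hyR
    have h4 := IsMaximalTree.degIn_eq (G := G) h.subset y
    have h5 := (mem_rim.1 hyR).2.2
    have h6 := h.degIn_outer_eq_zero hyR
    omega
  -- A vertex that `T` does not see forces, by connectedness and maximality, some vertex with two
  -- neighbours in `T`.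
  · have hy0 : G.degIn y T = 0 := by
      by_contra h0
      exact hyR (mem_rim.2 ⟨hy, hyT, by omega⟩)
    have hz : ∃ z ∈ W, z ∉ T ∧ 2 ≤ G.degIn z T := by
      by_contra hc
      push Not at hc
      have := hconn.degIn_eq_one h.subset ⟨v, h.matchedTree.mem⟩ h.maximal
        (fun z hz hzT => by have := hc z hz hzT; omega) hy hyT
      omega
    obtain ⟨z, hz, hzT, hz2⟩ := hz
    have := h.two_le_saving hsub hz hzT hz2
    omega

/-- The induction step when all degrees are three. -/
lemma exists_forest_of_degIn_eq_three {v : V} (hconn : G.ConnectedOn W)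
    (hsub : ∀ v (X : Finset V), G.degIn v X ≤ 3)
    (hK4 : ∀ a ∈ W, ∀ b ∈ W, ∀ c ∈ W, ∀ d ∈ W, ∀ e ∈ W, ¬ G.HasK4PlusAt a b c d e)
    (hK33 : ∀ a ∈ W, ∀ b ∈ W, ∀ c ∈ W, ∀ x ∈ W, ∀ y ∈ W, ∀ z ∈ W, ¬ G.HasK33MinusAt a b c x y z)
    (ih : ∀ S ⊆ W, S.card < W.card → ∃ F ⊆ S, G.MatchedForest F ∧
      G.pairsBetween S S ≤ 6 * F.card)
    (hv : v ∈ W) (hdeg : ∀ y ∈ W, G.degIn y W = 3) :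
    ∃ F ⊆ W, G.MatchedForest F ∧ G.pairsBetween W W ≤ 6 * F.card := by
  obtain ⟨T₀, hTW, hT, z, hz, hzT, hz2⟩ := exists_matchedTree_two_le hconn hv hsub hK4 hK33
    (by rw [hdeg v hv]; omega) fun y hy _ => hdeg y hy
  obtain ⟨T, hTT, h, hout⟩ := IsMaximalTree.exists_extension hT hTW
  obtain ⟨F, hF, hF', hle⟩ := ih _ outer_subset h.card_outer_lt
  refine h.exists_forest hF hF' (n := 0) ?_
  have hzR : z ∈ G.rim W T := mem_rim.2 ⟨hz, hout z hzT hz2, by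
    have := hz2.trans (degIn_mono hTT); omega⟩
  have hz2 := hz2.trans (degIn_mono hTT)
  -- `t r` is the part of the saving not accounted for by outer edges, in units of 3; it vanishes
  -- when `r` has one neighbour in `T`.
  set t := fun r => G.degIn r T - 1 - G.degIn r (G.outer W T) with ht
  have hsave : ∑ r ∈ G.rim W T, G.saving W T r =
      2 * G.pairsBetween (G.rim W T) (G.outer W T) + 3 * ∑ r ∈ G.rim W T, t r := by
    rw [pairsBetween, Finset.mul_sum, Finset.mul_sum, ← Finset.sum_add_distrib]
    refine Finset.sum_congr rfl fun r hr => ?_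
    have h1 := h.saving_add hsub hr
    have h2 := IsMaximalTree.degIn_eq (G := G) h.subset r
    have h3 := (mem_rim.1 hr).2.2
    have h4 := h.degIn_outer_eq_zero hr
    rw [hdeg r (mem_rim.1 hr).1] at h1 h2
    simp only [ht]
    by_cases h5 : G.degIn r T = 1
    · have := h4 h5
      omega
    · omega
  have hpos : 1 ≤ G.pairsBetween (G.rim W T) (G.outer W T) + ∑ r ∈ G.rim W T, t r := by
    have h1 := Finset.single_le_sum (f := fun r => G.degIn r (G.outer W T))
      (fun _ _ => Nat.zero_le _) hzR
    have h2 := Finset.single_le_sum (f := t) (fun _ _ => Nat.zero_le _) hzR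
    simp only [ht] at h1 h2 ⊢
    rw [pairsBetween]
    omega
  -- With p rim-to-outer edges, the outer degree sum is −p modulo 3. Parity makes the sum of `t`
  -- even: if positive, it saves 6. If it is 0, then p ≥ 1, and for p = 1, 2 the outer degree sum is
  -- 2, 4 modulo 6, hence at least 4, 2 below `6 * F.card`. This supplies the missing 6 − 2p.
  have hdegS : G.pairsBetween (G.outer W T) (G.outer W T) +
      G.pairsBetween (G.rim W T) (G.outer W T) = 3 * (G.outer W T).card := by
    rw [pairsBetween_comm (G.rim W T), pairsBetween, pairsBetween, ← Finset.sum_add_distrib,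
      mul_comm, ← smul_eq_mul, ← Finset.sum_const]
    refine Finset.sum_congr rfl fun x hx => ?_
    have h1 := IsMaximalTree.degIn_eq (G := G) h.subset x
    rw [hdeg x (mem_outer.1 hx).1, (mem_outer.1 hx).2.2] at h1
    omega
  have h2 := h.pairsBetween_add hsub
  obtain ⟨i, hi⟩ := even_pairsBetween_self (G := G) W
  obtain ⟨j, hj⟩ := even_pairsBetween_self (G := G) (G.outer W T)
  omega

/-! ### The exceptional configurations -/

lemma IsApex.mono {X : Finset V} {e : V} (h : G.IsApex X e) (hXW : X ⊆ W)
    (hcl : ∀ x ∈ X, ∀ y ∈ W, G.Adj x y → y ∈ X) : G.IsApex W e := by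
  obtain ⟨he, h2, a, ha, b, hb, c, hc, d, hd, hK⟩ := h
  refine ⟨hXW he, ?_, a, hXW ha, b, hXW hb, c, hXW hc, d, hXW hd, hK⟩
  rw [degIn_sdiff hXW, h2, degIn_eq_zero.2]
  intro x hx hadj
  rw [Finset.mem_sdiff] at hx
  exact hx.2 (hcl e he x hx.1 hadj)

/-- The vertices of `K₄⁺` other than the vertex of degree two have no further neighbours. -/
lemma HasK4PlusAt.mem_of_adj {a b c d e : V} (hsub : ∀ v (X : Finset V), G.degIn v X ≤ 3)
    (h : G.HasK4PlusAt a b c d e) {z : V} :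
    (G.Adj a z → z = e ∨ z = c ∨ z = d) ∧ (G.Adj b z → z = e ∨ z = c ∨ z = d) ∧
    (G.Adj c z → z = a ∨ z = b ∨ z = d) ∧ (G.Adj d z → z = a ∨ z = b ∨ z = c) := by
  obtain ⟨hea, heb, hac, had, hbc, hbd, hcd, hab, hec, hed⟩ := h
  exact ⟨fun hz => eq_of_three_adj hsub hea.symm hac had hz hec hed hcd.ne,
    fun hz => eq_of_three_adj hsub heb.symm hbc hbd hz hec hed hcd.ne,
    fun hz => eq_of_three_adj hsub hac.symm hbc.symm hcd hz hab had.ne hbd.ne,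
    fun hz => eq_of_three_adj hsub had.symm hbd.symm hcd.symm hz hab hac.ne hbc.ne⟩

lemma IsApex.eq {e : V} (hconn : G.ConnectedOn W) (hsub : ∀ v (X : Finset V), G.degIn v X ≤ 3)
    (h : G.IsApex W e) : ∃ a b c d, G.HasK4PlusAt a b c d e ∧ W = {e, a, b, c, d} := by
  obtain ⟨he, h2, a, ha, b, hb, c, hc, d, hd, hK⟩ := h
  refine ⟨a, b, c, d, hK, (hconn _ ?_ ⟨e, by simp⟩ ?_).symm⟩
  · simp [Finset.insert_subset_iff, *]
  · intro x hx y hy hxy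
    have hm := hK.mem_of_adj hsub (z := y)
    simp only [Finset.mem_insert, Finset.mem_singleton] at hx ⊢
    rcases hx with rfl | rfl | rfl | rfl | rfl
    · rcases eq_or_eq_of_degIn_le_two h2.le ha hb hy hK.1 hK.2.1 hxy hK.2.2.2.2.2.2.2.1
        with h | h <;> simp [h]
    · rcases hm.1 hxy with h | h | h <;> simp [h]
    · rcases hm.2.1 hxy with h | h | h <;> simp [h]
    · rcases hm.2.2.1 hxy with h | h | h <;> simp [h]
    · rcases hm.2.2.2 hxy with h | h | h <;> simp [h]

/-- The induction step when `W` contains `K₄⁺`, but is not equal to it. -/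
lemma exists_forest_of_hasK4PlusAt {a b c d e : V}
    (hsub : ∀ v (X : Finset V), G.degIn v X ≤ 3) (hno : ∀ e, ¬ G.IsApex W e)
    (ih : ∀ S : Finset V, S.card < W.card → ∃ F ⊆ S, G.MatchedForest F ∧
      G.pairsBetween S S ≤ 6 * F.card + 2 * G.apexCount S)
    (ha : a ∈ W) (hb : b ∈ W) (hc : c ∈ W) (hd : d ∈ W) (he : e ∈ W)
    (h : G.HasK4PlusAt a b c d e) :
    ∃ F ⊆ W, G.MatchedForest F ∧ G.pairsBetween W W ≤ 6 * F.card + 2 * G.apexCount W := by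
  have hm := fun z => h.mem_of_adj hsub (z := z)
  have h2 : G.degIn e W ≠ 2 := fun h2 => hno e ⟨he, h2, a, ha, b, hb, c, hc, d, hd, h⟩
  obtain ⟨hea, heb, hac, had, hbc, hbd, hcd, hab, hec, hed⟩ := h
  obtain ⟨x, hx, hex, hxa, hxb⟩ : ∃ x ∈ W, G.Adj e x ∧ x ≠ a ∧ x ≠ b := by
    have h2' := one_lt_degIn ha hb hab hea heb
    by_contra hc
    push Not at hc
    have : W.filter (G.Adj e) ⊆ {a, b} := by
      intro x hx
      simp only [Finset.mem_filter, Finset.mem_insert, Finset.mem_singleton] at hx ⊢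
      by_cases hxa : x = a
      · exact .inl hxa
      · exact .inr (hc x hx.1 hx.2 hxa)
    have h3 := (Finset.card_le_card this).trans Finset.card_le_two
    rw [degIn] at h2 h2'
    omega
  have hxc : x ≠ c := by
    rintro rfl
    rcases (hm e).2.2.1 hex.symm with h | h | h
    · exact hea.ne h
    · exact heb.ne h
    · exact hed h
  have hxd : x ≠ d := by
    rintro rfl
    rcases (hm e).2.2.2 hex.symm with h | h | h
    · exact hea.ne h
    · exact heb.ne h
    · exact hec h
  have hax : ¬ G.Adj a x := by
    intro h
    rcases (hm x).1 h with h | h | h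
    · exact hex.ne' h
    · exact hxc h
    · exact hxd h
  have hcx : ¬ G.Adj c x := by
    intro h
    rcases (hm x).2.2.1 h with h | h | h
    · exact hxa h
    · exact hxb h
    · exact hxd h
  have hce : ¬ G.Adj c e := by
    intro h
    rcases (hm e).2.2.1 h with h | h | h
    · exact hea.ne h
    · exact heb.ne h
    · exact hed h
  -- The third neighbour `x` of `e` makes room for this tree; `b` sees `e` and `c`, while `d` sees
  -- `a` and `c`.
  have hT : G.MatchedTree e (insert a (insert c {e, x})) := by
    refine .step _ _ _ (.base x hex) ?_ ?_ hac ?_ ?_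
    · simp [hea.ne', hxa.symm]
    · simp [hec.symm, hxc.symm]
    · rw [degIn_pair hex.ne, if_neg hax, if_pos hea.symm]
    · rw [degIn_pair hex.ne, if_neg hcx, if_neg hce]
  refine exists_forest_of_adj hsub hno ih hT ?_ hb hd ?_ ?_ hbd ?_ ?_
  · simp [Finset.insert_subset_iff, *]
  · simp [hab.symm, hbc.ne, heb.ne', hxb.symm]
  · simp [had.ne', hcd.ne', hed.symm, hxd.symm]
  · exact one_lt_degIn (x := e) (y := c) (by simp) (by simp) hec heb.symm hbc
  · exact one_lt_degIn (x := a) (y := c) (by simp) (by simp) hac.ne had.symm hcd.symm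

/-- The induction step when `W` contains `K₃,₃` minus an edge as an induced subgraph. -/
lemma exists_forest_of_hasK33MinusAt {a b c x y z : V}
    (hsub : ∀ v (X : Finset V), G.degIn v X ≤ 3) (hno : ∀ e, ¬ G.IsApex W e)
    (ih : ∀ S : Finset V, S.card < W.card → ∃ F ⊆ S, G.MatchedForest F ∧
      G.pairsBetween S S ≤ 6 * F.card + 2 * G.apexCount S)
    (ha : a ∈ W) (hb : b ∈ W) (hc : c ∈ W) (hx : x ∈ W) (hy : y ∈ W) (hz : z ∈ W)
    (h : G.HasK33MinusAt a b c x y z) (hax : ¬ G.Adj a x) :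
    ∃ F ⊆ W, G.MatchedForest F ∧ G.pairsBetween W W ≤ 6 * F.card + 2 * G.apexCount W := by
  obtain ⟨⟨hab, hac, hbc, hxy, hxz, hyz⟩, hay, haz, hbx, hby, hbz, hcx, hcy, hcz⟩ := h
  have hax' : a ≠ x := by
    rintro rfl
    rcases eq_of_three_adj hsub hbx.symm hcx.symm hay haz hbc hby.ne hcy.ne with h | h | h
    · exact hbz.ne' h
    · exact hcz.ne' h
    · exact hyz.symm h
  have hba : ¬ G.Adj b a := by
    intro h
    rcases eq_of_three_adj hsub hbx hby hbz h hxy hxz hyz with h | h | h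
    · exact hax' h
    · exact hay.ne h
    · exact haz.ne h
  have hyx : ¬ G.Adj x y := by
    intro h
    rcases eq_of_three_adj hsub hay.symm hby.symm hcy.symm h.symm hab hac hbc with h | h | h
    · exact hax' h.symm
    · exact hbx.ne' h
    · exact hcx.ne' h
  -- Outside this tree, `z` sees `a` and `b`, while `c` sees `x` and `y`.
  have hT : G.MatchedTree a (insert b (insert x {a, y})) := by
    refine .step _ _ _ (.base y hay) ?_ ?_ hbx ?_ ?_
    · simp [hab.symm, hby.ne]
    · simp [hax'.symm, hxy]
    · rw [degIn_pair hay.ne, if_neg hba, if_pos hby]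
    · rw [degIn_pair hay.ne, if_neg hyx, if_neg fun h => hax h.symm]
  refine exists_forest_of_adj hsub hno ih hT ?_ hz hc ?_ ?_ hcz.symm ?_ ?_
  · simp [Finset.insert_subset_iff, *]
  · simp [haz.ne', hbz.ne', hyz.symm, hxz.symm]
  · simp [hac.symm, hbc.symm, hcx.ne, hcy.ne]
  · exact one_lt_degIn (x := a) (y := b) (by simp) (by simp) hab haz.symm hbz.symm
  · exact one_lt_degIn (x := x) (y := y) (by simp) (by simp) hxy hcx hcy

/-! ### The induction -/

/-- A subcubic graph without `K₃,₃` has a matched forest whose size is bounded from below in terms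
of the number of edges and the number of components isomorphic to `K₄⁺`. -/
theorem exists_matchedForest (hsub : ∀ v (X : Finset V), G.degIn v X ≤ 3)
    (hK33 : ∀ a b c x y z, G.HasK33MinusAt a b c x y z → ¬ G.Adj a x) (W : Finset V) :
    ∃ F ⊆ W, G.MatchedForest F ∧ G.pairsBetween W W ≤ 6 * F.card + 2 * G.apexCount W := by
  classical
  induction hn : W.card using Nat.strong_induction_on generalizing W with
  | _ n ih =>
    replace ih : ∀ S : Finset V, S.card < W.card → ∃ F ⊆ S, G.MatchedForest F ∧
      G.pairsBetween S S ≤ 6 * F.card + 2 * G.apexCount S := fun S hS => ih _ (hn ▸ hS) S rfl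
    by_cases hconn : G.ConnectedOn W
    swap
    · rw [ConnectedOn] at hconn
      push Not at hconn
      obtain ⟨X, hXW, hXne, hcl, hXW'⟩ := hconn
      have hd : Disjoint X (W \ X) := Finset.disjoint_sdiff
      have hcl' : ∀ x ∈ W \ X, ∀ y ∈ W, G.Adj x y → y ∈ W \ X := by
        intro x hx y hy hxy
        rw [Finset.mem_sdiff] at hx ⊢
        exact ⟨hy, fun hyX => hx.2 (hcl y hyX x hx.1 hxy.symm)⟩
      have hnadj : ∀ x ∈ X, ∀ y ∈ W \ X, ¬ G.Adj x y := fun x hx y hy hxy =>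
        (Finset.mem_sdiff.1 hy).2 (hcl x hx y (Finset.mem_sdiff.1 hy).1 hxy)
      obtain ⟨F₁, h₁, hF₁, hle₁⟩ := ih X (Finset.card_lt_card (hXW.ssubset_of_ne hXW'))
      obtain ⟨F₂, h₂, hF₂, hle₂⟩ := ih (W \ X) (Finset.card_lt_card
        (Finset.sdiff_ssubset hXW hXne))
      have hdF : Disjoint F₁ F₂ := Finset.disjoint_of_subset_left h₁
        (Finset.disjoint_of_subset_right h₂ hd)
      refine ⟨F₁ ∪ F₂, Finset.union_subset (h₁.trans hXW) (h₂.trans Finset.sdiff_subset),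
        hF₁.union hF₂ hdF fun x hx y hy => hnadj x (h₁ hx) y (h₂ hy), ?_⟩
      have hcount : G.apexCount X + G.apexCount (W \ X) ≤ G.apexCount W := by
        rw [apexCount, apexCount, ← Finset.card_union_of_disjoint
          (Finset.disjoint_of_subset_left (Finset.filter_subset _ _)
            (Finset.disjoint_of_subset_right (Finset.filter_subset _ _) hd))]
        refine Finset.card_le_card fun e he => ?_
        simp only [Finset.mem_union, Finset.mem_filter] at he ⊢
        rcases he with he | he
        · exact ⟨hXW he.1, he.2.mono hXW hcl⟩
        · exact ⟨Finset.sdiff_subset he.1, he.2.mono Finset.sdiff_subset hcl'⟩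
      have h0 := pairsBetween_eq_zero hnadj
      have h1 : G.pairsBetween W W = G.pairsBetween X X + G.pairsBetween (W \ X) (W \ X) := by
        conv_lhs => rw [← Finset.union_sdiff_of_subset hXW, pairsBetween_union_left hd,
          pairsBetween_union_right hd, pairsBetween_union_right hd, pairsBetween_comm (W \ X) X]
        rw [h0]
        omega
      rw [Finset.card_union_of_disjoint hdF]
      omega
    by_cases hno : ∀ e, ¬ G.IsApex W e
    swap
    · push Not at hno
      obtain ⟨e, he⟩ := hno
      obtain ⟨a, b, c, d, hK, hW⟩ := he.eq hconn hsub
      obtain ⟨heW, he2, -⟩ := id he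
      have hcd := hK.2.2.2.2.2.2.1
      -- `K₄⁺` has 7 edges, and 14 = 6 · 2 + 2 · 1 is tight.
      refine ⟨{c, d}, by simp [hW, Finset.insert_subset_iff], .pair hcd, ?_⟩
      have h1 : 1 ≤ G.apexCount W :=
        Finset.card_pos.2 ⟨e, Finset.mem_filter.2 ⟨heW, he⟩⟩
      have h2 : G.pairsBetween W W ≤ 14 := by
        rw [pairsBetween, ← Finset.add_sum_erase _ _ heW, he2]
        have h3 : W.erase e ⊆ {a, b, c, d} := by
          intro x hx
          rw [Finset.mem_erase, hW, Finset.mem_insert] at hx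
          exact hx.2.resolve_left hx.1
        have h4 := (Finset.card_le_card h3).trans Finset.card_le_four
        have h5 := Finset.sum_le_card_nsmul (W.erase e) (fun x => G.degIn x W) 3
          fun x _ => hsub x W
        rw [smul_eq_mul] at h5
        omega
      rw [Finset.card_pair hcd.ne]
      omega
    by_cases hK4 : ∀ a ∈ W, ∀ b ∈ W, ∀ c ∈ W, ∀ d ∈ W, ∀ e ∈ W, ¬ G.HasK4PlusAt a b c d e
    swap
    · push Not at hK4
      obtain ⟨a, ha, b, hb, c, hc, d, hd, e, he, h⟩ := hK4
      exact exists_forest_of_hasK4PlusAt hsub hno ih ha hb hc hd he h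
    by_cases hK33' : ∀ a ∈ W, ∀ b ∈ W, ∀ c ∈ W, ∀ x ∈ W, ∀ y ∈ W, ∀ z ∈ W,
        ¬ G.HasK33MinusAt a b c x y z
    swap
    · push Not at hK33'
      obtain ⟨a, ha, b, hb, c, hc, x, hx, y, hy, z, hz, h⟩ := hK33'
      exact exists_forest_of_hasK33MinusAt hsub hno ih ha hb hc hx hy hz h
        (hK33 _ _ _ _ _ _ h)
    suffices ∃ F ⊆ W, G.MatchedForest F ∧ G.pairsBetween W W ≤ 6 * F.card by
      obtain ⟨F, h1, h2, h3⟩ := this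
      exact ⟨F, h1, h2, by omega⟩
    -- No subset of `W` contains `K₄⁺` any more, so the correction term disappears.
    have ih' : ∀ S ⊆ W, S.card < W.card → ∃ F ⊆ S, G.MatchedForest F ∧
        G.pairsBetween S S ≤ 6 * F.card := by
      intro S hSW hS
      obtain ⟨F, h1, h2, h3⟩ := ih S hS
      have h0 : G.apexCount S = 0 := by
        rw [apexCount, Finset.card_eq_zero, Finset.filter_eq_empty_iff]
        rintro e - ⟨he, -, a, ha, b, hb, c, hc, d, hd, h⟩
        exact hK4 a (hSW ha) b (hSW hb) c (hSW hc) d (hSW hd) e (hSW he) h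
      exact ⟨F, h1, h2, by omega⟩
    by_cases h0 : ∃ v ∈ W, G.degIn v W = 0
    · obtain ⟨v, hv, hv0⟩ := h0
      have hW : {v} = W := hconn {v} (by simpa using hv) (by simp) fun x hx y hy hxy => by
        rw [Finset.mem_singleton] at hx
        exact absurd (hx ▸ hxy) (degIn_eq_zero.1 hv0 y hy)
      refine ⟨∅, by simp, .empty, ?_⟩
      rw [← hW] at hv0 ⊢
      simp [pairsBetween, hv0]
    push Not at h0
    rcases W.eq_empty_or_nonempty with rfl | ⟨v, hv⟩
    · exact ⟨∅, by simp, .empty, by simp [pairsBetween]⟩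
    by_cases h2 : ∃ v ∈ W, G.degIn v W ≤ 2
    · obtain ⟨v, hv, hv2⟩ := h2
      exact exists_forest_of_degIn_le_two hconn hsub hK4 hK33' ih' hv
        (Nat.pos_of_ne_zero (h0 v hv)) hv2
    · push Not at h2
      refine exists_forest_of_degIn_eq_three hconn hsub hK4 hK33' ih' hv fun y hy => ?_
      have h3 := h2 y hy
      have h4 := hsub y W
      omega

/-! ### From matched forests to acyclic matchings -/

lemma MatchedForest.exists_isMatching {F : Finset V} (h : G.MatchedForest F) :
    ∃ M : G.Subgraph, M.verts = F ∧ M.IsMatching ∧ M.edgeSet.Finite ∧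
      F.card = 2 * M.edgeSet.ncard := by
  induction h with
  | empty => exact ⟨⊥, by simp, fun v hv => absurd hv (by simp), by simp, by simp⟩
  | step F x y _ hx hy hxy _ _ ih =>
    obtain ⟨M, hMF, hM, hfin, hcard⟩ := ih
    have hnot : s(x, y) ∉ M.edgeSet := fun h => hx (by
      have := M.edge_vert (Subgraph.mem_edgeSet.1 h)
      rwa [hMF] at this)
    refine ⟨G.subgraphOfAdj hxy ⊔ M, ?_, ?_, ?_, ?_⟩
    · rw [Subgraph.verts_sup, hMF]
      ext z
      simp [or_assoc]
    · refine (Subgraph.IsMatching.subgraphOfAdj hxy).sup hM ?_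
      rw [hM.support_eq_verts, hMF, support_subgraphOfAdj]
      simp [Set.disjoint_left, hx, hy]
    · rw [Subgraph.edgeSet_sup, edgeSet_subgraphOfAdj]
      exact (Set.finite_singleton _).union hfin
    · rw [Subgraph.edgeSet_sup, edgeSet_subgraphOfAdj, Set.singleton_union,
        Set.ncard_insert_of_notMem hnot hfin, Finset.card_insert_of_notMem (by simp [hx, hxy.ne]),
        Finset.card_insert_of_notMem hy, hcard]
      ring

/-- A matched forest contains no nonempty set inducing a graph of minimum degree two. -/
lemma MatchedForest.eq_empty {F C : Finset V} (h : G.MatchedForest F) (hC : C ⊆ F)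
    (h2 : ∀ x ∈ C, 2 ≤ G.degIn x C) : C = ∅ := by
  induction h with
  | empty => simpa using hC
  | step F x y _ hx hy hxy hx1 hy0 ih =>
    -- The vertex `y` added last is a leaf; once it is excluded, `x` has at most one neighbour left.
    have hyC : y ∉ C := by
      intro hyC
      have h1 := (h2 y hyC).trans (degIn_mono hC)
      rw [degIn_insert_insert hxy.ne hx hy, hy0] at h1
      simp at h1
      split_ifs at h1 <;> omega
    have hC' : C ⊆ insert x F := by
      intro z hz
      have := hC hz
      simp only [Finset.mem_insert] at this ⊢
      rcases this with h | rfl | h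
      · exact .inl h
      · exact absurd hz hyC
      · exact .inr h
    have hxC : x ∉ C := by
      intro hxC
      have h1 := (h2 x hxC).trans (degIn_mono hC')
      rw [degIn_insert hx, if_neg (by simp)] at h1
      omega
    exact ih ((Finset.subset_insert_iff_of_notMem hxC).1 hC')

/-- The vertices of a cycle would induce minimum degree two, contradicting `MatchedForest.eq_empty`.
-/
lemma MatchedForest.isAcyclic {F : Finset V} (h : G.MatchedForest F) :
    (G.induce (F : Set V)).IsAcyclic := by
  intro v c hc
  set C : Finset V := c.support.toFinset.map (Function.Embedding.subtype _) with hCdef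
  have hmem : ∀ z, z ∈ C ↔ ∃ hz : z ∈ (F : Set V), (⟨z, hz⟩ : (F : Set V)) ∈ c.support := by
    simp [hCdef]
  have hCF : C ⊆ F := fun z hz => ((hmem z).1 hz).1
  have hC := h.eq_empty hCF (by
    intro x hx
    obtain ⟨hxF, hx⟩ := (hmem x).1 hx
    have h2 := hc.ncard_neighborSet_toSubgraph_eq_two hx
    obtain ⟨s, t, hst, hset⟩ := Set.ncard_eq_two.1 h2
    have key : ∀ s ∈ c.toSubgraph.neighborSet ⟨x, hxF⟩, (s : V) ∈ C ∧ G.Adj x s := by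
      intro s hs
      have hs' : c.toSubgraph.Adj ⟨x, hxF⟩ s := hs
      refine ⟨(hmem _).2 ⟨s.2, ?_⟩, hs'.adj_sub⟩
      exact (Walk.mem_verts_toSubgraph _).1 hs'.snd_mem
    have hs := key s (by simp [hset])
    have ht := key t (by simp [hset])
    exact one_lt_degIn hs.1 ht.1 (fun h => hst (Subtype.ext h)) hs.2 ht.2)
  have hv : (v : V) ∈ C := (hmem v).2 ⟨v.2, c.start_mem_support⟩
  simp [hC] at hv

/-! ### Recognising the two exceptional graphs, and the conclusion -/

lemma Connected.connectedOn_univ [Fintype V] (h : G.Connected) :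
    G.ConnectedOn (Finset.univ : Finset V) := by
  rintro X - ⟨x, hx⟩ hcl
  refine Finset.eq_univ_of_forall fun y => ?_
  obtain ⟨p⟩ := h.preconnected x y
  induction p with
  | nil => exact hx
  | cons hadj _ ih => exact ih (hcl _ hx _ (Finset.mem_univ _) hadj)

lemma nonempty_iso_of_adj_iff {W : Type*} {H : SimpleGraph W} (f : W → V)
    (hf : Function.Bijective f) (h : ∀ i j, G.Adj (f i) (f j) ↔ H.Adj i j) :
    Nonempty (G ≃g H) :=
  ⟨(RelIso.mk (Equiv.ofBijective f hf) (by intro i j; exact h i j) : H ≃g G).symm⟩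

lemma IsApex.nonempty_iso [Fintype V] (hconn : G.Connected)
    (hsub : ∀ v (X : Finset V), G.degIn v X ≤ 3) {e : V} (h : G.IsApex Finset.univ e) :
    Nonempty (G ≃g K4Plus) := by
  obtain ⟨a, b, c, d, hK, hW⟩ := h.eq hconn.connectedOn_univ hsub
  have hm := fun z => hK.mem_of_adj hsub (z := z)
  obtain ⟨hea, heb, hac, had, hbc, hbd, hcd, hab, hec, hed⟩ := hK
  have hab' : ¬ G.Adj a b := fun h => by
    rcases (hm b).1 h with h | h | h
    exacts [heb.ne' h, hbc.ne h, hbd.ne h]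
  have hce' : ¬ G.Adj c e := fun h => by
    rcases (hm e).2.2.1 h with h | h | h
    exacts [hea.ne h, heb.ne h, hed h]
  have hde' : ¬ G.Adj d e := fun h => by
    rcases (hm e).2.2.2 h with h | h | h
    exacts [hea.ne h, heb.ne h, hec h]
  refine nonempty_iso_of_adj_iff ![a, b, c, d, e] ⟨?_, ?_⟩ ?_
  · intro i j hij
    fin_cases i <;> fin_cases j <;>
      simp_all [hea.ne, heb.ne, hac.ne, had.ne, hbc.ne, hbd.ne, hcd.ne, hea.ne', heb.ne', hac.ne',
        had.ne', hbc.ne', hbd.ne', hcd.ne', hab.symm, hec.symm, hed.symm]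
  · intro z
    have hz : z ∈ ({e, a, b, c, d} : Finset V) := hW ▸ Finset.mem_univ z
    simp only [Finset.mem_insert, Finset.mem_singleton] at hz
    rcases hz with rfl | rfl | rfl | rfl | rfl
    exacts [⟨4, rfl⟩, ⟨0, rfl⟩, ⟨1, rfl⟩, ⟨2, rfl⟩, ⟨3, rfl⟩]
  · intro i j
    fin_cases i <;> fin_cases j <;>
      simp [K4Plus, hea, heb, hac, had, hbc, hbd, hcd, hea.symm, heb.symm, hac.symm, had.symm,
        hbc.symm, hbd.symm, hcd.symm, hab', hce', hde', G.adj_comm b a, G.adj_comm e c,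
        G.adj_comm e d]

lemma HasK33MinusAt.nonempty_iso [Fintype V] (hconn : G.Connected)
    (hsub : ∀ v (X : Finset V), G.degIn v X ≤ 3) {a b c x y z : V}
    (h : G.HasK33MinusAt a b c x y z) (hax : G.Adj a x) :
    Nonempty (G ≃g completeBipartiteGraph (Fin 3) (Fin 3)) := by
  obtain ⟨⟨hab, hac, hbc, hxy, hxz, hyz⟩, hay, haz, hbx, hby, hbz, hcx, hcy, hcz⟩ := h
  have hl : ∀ t ∈ ({a, b, c} : Finset V), ∀ s, G.Adj t s ↔ s ∈ ({x, y, z} : Finset V) := by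
    intro t ht s
    simp only [Finset.mem_insert, Finset.mem_singleton] at ht ⊢
    rcases ht with rfl | rfl | rfl
    · exact ⟨fun h => eq_of_three_adj hsub hax hay haz h hxy hxz hyz, by
        rintro (rfl | rfl | rfl) <;> assumption⟩
    · exact ⟨fun h => eq_of_three_adj hsub hbx hby hbz h hxy hxz hyz, by
        rintro (rfl | rfl | rfl) <;> assumption⟩
    · exact ⟨fun h => eq_of_three_adj hsub hcx hcy hcz h hxy hxz hyz, by
        rintro (rfl | rfl | rfl) <;> assumption⟩
  have hr : ∀ t ∈ ({x, y, z} : Finset V), ∀ s, G.Adj t s ↔ s ∈ ({a, b, c} : Finset V) := by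
    intro t ht s
    refine ⟨fun h => ?_, fun hs => ((hl s hs t).2 ht).symm⟩
    simp only [Finset.mem_insert, Finset.mem_singleton] at ht ⊢
    rcases ht with rfl | rfl | rfl
    · exact eq_of_three_adj hsub hax.symm hbx.symm hcx.symm h hab hac hbc
    · exact eq_of_three_adj hsub hay.symm hby.symm hcy.symm h hab hac hbc
    · exact eq_of_three_adj hsub haz.symm hbz.symm hcz.symm h hab hac hbc
  have hd : ∀ t ∈ ({a, b, c} : Finset V), t ∉ ({x, y, z} : Finset V) := fun t ht ht' =>
    G.irrefl ((hl t ht t).2 ht')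
  have hun := hconn.connectedOn_univ ({a, b, c} ∪ {x, y, z}) (Finset.subset_univ _)
    ⟨a, by simp⟩ (by
      intro t ht s _ hts
      rw [Finset.mem_union] at ht ⊢
      rcases ht with ht | ht
      · exact .inr ((hl t ht s).1 hts)
      · exact .inl ((hr t ht s).1 hts))
  have hfl : ∀ i, ![a, b, c] i ∈ ({a, b, c} : Finset V) := by
    intro i; fin_cases i <;> simp
  have hfr : ∀ i, ![x, y, z] i ∈ ({x, y, z} : Finset V) := by
    intro i; fin_cases i <;> simp
  have hinj : ∀ {a b c : V}, a ≠ b → a ≠ c → b ≠ c → Function.Injective ![a, b, c] := by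
    intro a b c hab hac hbc i j hij
    fin_cases i <;> fin_cases j <;> simp_all [hab.symm, hac.symm, hbc.symm]
  refine nonempty_iso_of_adj_iff (Sum.elim ![a, b, c] ![x, y, z]) ⟨?_, ?_⟩ ?_
  · refine (hinj hab hac hbc).sumElim (hinj hxy hxz hyz) fun i j hij => ?_
    exact hd _ (hfl i) (hij ▸ hfr j)
  · intro t
    have ht : t ∈ ({a, b, c} ∪ {x, y, z} : Finset V) := hun ▸ Finset.mem_univ t
    simp only [Finset.mem_union, Finset.mem_insert, Finset.mem_singleton] at ht
    rcases ht with (rfl | rfl | rfl) | (rfl | rfl | rfl)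
    exacts [⟨.inl 0, rfl⟩, ⟨.inl 1, rfl⟩, ⟨.inl 2, rfl⟩, ⟨.inr 0, rfl⟩, ⟨.inr 1, rfl⟩,
      ⟨.inr 2, rfl⟩]
  · rintro (i | i) (j | j)
    · simpa [hl _ (hfl i)] using hd _ (hfl j)
    · simpa [hl _ (hfl i)] using hfr j
    · simpa [hr _ (hfr i)] using hfl j
    · simpa [hr _ (hfr i)] using fun h => hd _ h (hfr j)

end SimpleGraph

theorem theorem1 {V : Type*} [Fintype V] (G : SimpleGraph V)
    [DecidableRel G.Adj] (hconn : G.Connected) (hsub : ∀ v : V, G.degree v ≤ 3)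
    (hK4 : ¬ Nonempty (G ≃g SimpleGraph.K4Plus))
    (hK33 : ¬ Nonempty (G ≃g completeBipartiteGraph (Fin 3) (Fin 3))) :
    (G.edgeFinset.card : ℝ) / 6 ≤ (G.acyclicMatchingNumber : ℝ) := by
  classical
  have hdeg : ∀ v, G.degIn v Finset.univ = G.degree v := fun v => by
    rw [SimpleGraph.degIn, ← SimpleGraph.card_neighborFinset_eq_degree,
      SimpleGraph.neighborFinset_eq_filter]
  have hsub' : ∀ v (X : Finset V), G.degIn v X ≤ 3 := fun v X =>
    (SimpleGraph.degIn_mono (Finset.subset_univ X)).trans ((hdeg v).trans_le (hsub v))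
  obtain ⟨F, -, hF, hle⟩ := SimpleGraph.exists_matchedForest hsub'
    (fun a b c x y z h hax => hK33 (h.nonempty_iso hconn hsub' hax)) Finset.univ
  have h0 : G.apexCount Finset.univ = 0 := by
    rw [SimpleGraph.apexCount, Finset.card_eq_zero, Finset.filter_eq_empty_iff]
    exact fun e _ he => hK4 (he.nonempty_iso hconn hsub')
  have hedges : G.pairsBetween Finset.univ Finset.univ = 2 * G.edgeFinset.card := by
    rw [← SimpleGraph.sum_degrees_eq_twice_card_edges, SimpleGraph.pairsBetween]
    exact Finset.sum_congr rfl fun v _ => hdeg v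
  obtain ⟨M, hMF, hM, -, hcard⟩ := hF.exists_isMatching
  have hMac : G.IsAcyclicMatching M := ⟨hM, hMF ▸ hF.isAcyclic⟩
  have hnu := (SimpleGraph.isGreatest_acyclicMatchingNumber G).2 ⟨M, hMac, rfl⟩
  have hfin : G.edgeFinset.card ≤ 6 * G.acyclicMatchingNumber := by omega
  rw [div_le_iff₀ (by norm_num), mul_comm]
  exact_mod_cast hfin
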